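/- **Theorem (Minami-type bound for regular randelette expansions).** Let $d,\nu\ge 1$, let $\Omega=\mathbb T^\nu=(\mathbb R/\mathbb Z)^\nu$ carry the normalized Haar measure $\mathbb P$ and the max-distance $\mathrm{dist}$, and let $(\Theta,\mathfrak B,\mu)$ be a probability space. Let $T:\mathbb Z^d\times\Omega\to\Omega$ be a measure-preserving action of $\mathbb Z^d$ with *uniformly slow returns*: for some $A,C\in(0,\infty)$, $$\mathrm{dist}(T^x\omega,T^y\omega)\ \ge\ 4C\,\|x-y\|^{-A}\qquad\text{for all }\omega\in\Omega\text{ and all }x\neq y\text{ in }\mathbb Z^d,$$ where $\|x\|=\max_i|x_i|$. Consider a *regular randelette expansion* $$v(\omega,\theta)=\sum_{n=0}^\infty a_n\sum_{k=1}^{K_n}\theta_{n,k}\,\varphi_{n,k}(\omega),$$ that is: * the $\theta_{n,k}$ are independent random variables on $(\Theta,\mathfrak B,\mu)$, each uniformly distributed on $[0,1]$; * the $\varphi_{n,k}:\Omega\to\mathbb R$ are measurable, and every $\omega\in\Omega$ belongs, for each $n$, to at most $K'$ of the sets $\operatorname{supp}\varphi_{n,k}$, with $K'$ independent of $n$ and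 $\omega$; * $\operatorname{diam}\operatorname{supp}\varphi_{n,k}\le D\,2^{-n}$ for all $n,k$, with some constant $D$; * for every $n\ge1$ and every $\omega\in\Omega$ there is a $k$ with $\varphi_{n,k}(\omega)=1$; * $a_n\ge\kappa e^{-cn}$ for all $n$, with some constants $\kappa,c>0$ (for example $a_n=e^{-cn}$); * $\sum_n a_n\sum_k|\varphi_{n,k}(\omega)|<\infty$ for every $\omega\in\Omega$. Fix $g>0$. For $u\in\mathbb Z^d$ and $L>0$ let $\Lambda_L(u)=\{x\in\mathbb Z^d:\|x-u\|\le L\}$, and let $H_{\Lambda_L(u)}(\omega,\theta)$ be the restriction to $\Lambda_L(u)$, with Dirichlet boundary conditions, of the operator $$(H(\omega,\theta)f)(x)=\sum_{y:\,|y-x|_1=1}f(y)+g\,v(T^x\omega,\theta)f(x),\qquad x\in\mathbb Z^d .$$ Write $\Pi_I(\cdot)$ for the spectral projection onto $I$, so that $\operatorname{tr}\Pi_I(H_{\Lambda_L(u)}(\omega,\theta))$ is the number of eigenvalues in $I$, counted with multiplicity. Then for every integer $J\ge 0$ and all sufficiently large $B'\in(0,\infty)$ there is a constant $C_{10}\in(0,\infty)$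 such that for every bounded interval $I\subset\mathbb R$ of length $|I|$, every $u\in\mathbb Z^d$ and every real $L\ge 1$ $$(\mathbb P\times\mu)\big\{\operatorname{tr}\Pi_I\big(H_{\Lambda_L(u)}(\omega,\theta)\big)\ge J\big\}\ \le\ C_{10}\,L^{B'}\,|I|^J .$$ -/

import Mathlib

open MeasureTheory ProbabilityTheory Set

/-- The integer lattice `ℤ^d`. Mathlib equips it with the max-norm `‖x‖ = max_i |x_i|`. -/
abbrev LatticeZ (d : ℕ) : Type := Fin d → ℤ

/-- The torus `𝕋^ν`, with the max-distance built from the usual distance of `ℝ/ℤ`, and with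
`volume` the normalized Haar measure. -/
abbrev Torus (ν : ℕ) : Type := Fin ν → UnitAddCircle

/-! ### The dynamical system -/

/-- `T` is a measure-preserving action of `ℤ^d` on the torus (a dynamical system with discrete
time `ℤ^d`). -/
structure IsDynamicalSystem {d ν : ℕ} (T : LatticeZ d → Torus ν → Torus ν) : Prop where
  zero : ∀ ω, T 0 ω = ω
  add : ∀ x y ω, T (x + y) ω = T x (T y ω)
  measurePreserving : ∀ x, MeasurePreserving (T x) volume volume

/-- Uniformly slow returns. -/
def UniformlySlowReturns {d ν : ℕ} (T : LatticeZ d → Torus ν → Torus ν) : Prop :=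
  ∃ A C : ℝ, 0 < A ∧ 0 < C ∧ ∀ (ω : Torus ν) (x y : LatticeZ d), x ≠ y →
    4 * C * ‖x - y‖ ^ (-A) ≤ dist (T x ω) (T y ω)

/-! ### Randelette expansions -/

/-- The deterministic data of a randelette expansion: for each generation `n`, the generation
amplitude `a n` and finitely many randelettes `φ n k`, `k` ranging over `K n` values. -/
structure Randelettes (ν : ℕ) where
  /-- the number of randelettes in each generation -/
  K : ℕ → ℕ
  /-- the generation amplitudes -/
  a : ℕ → ℝ
  /-- the randelettes -/
  φ : (n : ℕ) → Fin (K n) → Torus ν → ℝ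

namespace Randelettes

/-- Regularity of a randelette family. -/
structure IsRegular {ν : ℕ} (R : Randelettes ν) : Prop where
  measurable : ∀ n k, Measurable (R.φ n k)
  /-- the supports within one generation have uniformly bounded overlap -/
  overlap : ∃ K' : ℕ, ∀ (n : ℕ) (ω : Torus ν), {k | ω ∈ tsupport (R.φ n k)}.ncard ≤ K'
  /-- the randelettes of generation `n` live on the scale `2 ^ (-n)` -/
  diam_support : ∃ D : ℝ, ∀ n k, Metric.diam (tsupport (R.φ n k)) ≤ D * 2 ^ (-(n : ℝ))
  /-- in each generation, every point of the torus is a point where some randelette equals one -/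
  covering : ∀ n : ℕ, 1 ≤ n → ∀ ω : Torus ν, ∃ k, R.φ n k ω = 1
  /-- the generation amplitudes decay at most exponentially -/
  amplitude : ∃ κ c : ℝ, 0 < κ ∧ 0 < c ∧ ∀ n : ℕ, κ * Real.exp (-(c * n)) ≤ R.a n
  /-- the expansion converges, whatever the values of the coefficients in `[0, 1]` -/
  summable : ∀ ω : Torus ν, Summable fun n => R.a n * ∑ k, |R.φ n k ω|

/-- The coefficients `θ n k` are independent random variables on `(Θ, μ)`, each uniformly
distributed on `[0, 1]`. -/
structure UniformIID {ν : ℕ} (R : Randelettes ν) {Θ : Type*} [MeasurableSpace Θ] (μ : Measure Θ)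
    (θ : (n : ℕ) → Fin (R.K n) → Θ → ℝ) : Prop where
  measurable : ∀ n k, Measurable (θ n k)
  law : ∀ n k, μ.map (θ n k) = volume.restrict (Icc (0 : ℝ) 1)
  indep : iIndepFun (fun i : (n : ℕ) × Fin (R.K n) => θ i.1 i.2) μ

/-- The hull `v(ω, ϑ) = ∑_n a_n ∑_k θ_{n,k}(ϑ) φ_{n,k}(ω)`. -/
noncomputable def hull {ν : ℕ} (R : Randelettes ν) {Θ : Type*}
    (θ : (n : ℕ) → Fin (R.K n) → Θ → ℝ) (ω : Torus ν) (ϑ : Θ) : ℝ :=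
  ∑' n, R.a n * ∑ k, θ n k ϑ * R.φ n k ω

end Randelettes

/-! ### Finite-volume lattice Schrödinger operators -/

/-- The matrix, in the standard basis of `ℓ²(ℤ^d)`, of the lattice Schrödinger operator
`(H f)(x) = ∑_{|y - x|₁ = 1} f(y) + W(x) f(x)`. -/
def schrodinger {d : ℕ} (W : LatticeZ d → ℝ) : Matrix (LatticeZ d) (LatticeZ d) ℝ :=
  Matrix.of fun x y => (if ∑ i, |y i - x i| = 1 then 1 else 0) + (if x = y then W x else 0)

theorem finite_cube {d : ℕ} (u : LatticeZ d) (L : ℝ) :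
    (Metric.closedBall u L).Finite :=
  (isCompact_closedBall u L).finite_of_discrete

/-- The lattice cube `{x ∈ ℤ^d : ‖x - u‖ ≤ L}`. -/
noncomputable def cube {d : ℕ} (u : LatticeZ d) (L : ℝ) : Finset (LatticeZ d) :=
  (finite_cube u L).toFinset

/-- The restriction of the Schrödinger operator to a finite set `Λ`, with Dirichlet boundary
conditions outside `Λ`. -/
def finiteVolume {d : ℕ} (W : LatticeZ d → ℝ) (Λ : Finset (LatticeZ d)) : Matrix Λ Λ ℝ :=
  (schrodinger W).submatrix (fun x => (x : LatticeZ d)) (fun x => (x : LatticeZ d))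

theorem finiteVolume_isHermitian {d : ℕ} (W : LatticeZ d → ℝ) (Λ : Finset (LatticeZ d)) :
    (finiteVolume W Λ).IsHermitian := by
  ext x y
  simp only [finiteVolume, schrodinger, Matrix.conjTranspose_apply, Matrix.submatrix_apply,
    Matrix.of_apply, star_trivial, abs_sub_comm]
  by_cases h : (x : LatticeZ d) = y
  · simp [h]
  · simp [h, Ne.symm h]

/-- The spectral projection `Π_I(H) = 1_I(H)` of a real symmetric matrix. -/
noncomputable def spectralProjection {n : Type*} [Fintype n] [DecidableEq n] {H : Matrix n n ℝ}
    (hH : H.IsHermitian) (I : Set ℝ) : Matrix n n ℝ :=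
  hH.cfc (I.indicator 1)

open scoped ENNReal

/-! ### A Minami bound for integer-valued monotone functions on a product space -/

/-! Fix `ω`. The orbit points indexed by the cube are separated by a negative power of `L`, so a
generation `n` of order `log L` has supports too small to contain two of them. Each lattice site
then owns a randelette of that generation, equal to one at its orbit point and zero at the others.
With all other coefficients frozen, the potential has independent site variables, each `g * a n`
times a uniform variable, and `1 / a n` is at most a power of `L`.

It remains to prove a Minami bound for a matrix with independent uniform diagonal entries. The
eigenvalue count below a fixed level is decreasing in each entry and changes by at most one when a
single entry moves. Raising the whole diagonal by `ε` shifts the spectrum, so `J` eigenvalues in an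
interval of length `ε` become a drop of the count by at least `J`. Shifting one entry at a time and
inducting on `J` (`pi_drop_le`) bounds the probability of such a drop by the `J`-th power of the
number of sites times the rescaled `ε`. The bound is uniform in `ω` and in the frozen coefficients;
integrating over both finishes the proof (`measure_drop_le_of_iIndepFun`, `measure_hull_drop_le`).
-/

theorem volume_setOf_drop_le {h : ℝ → ℕ} (hanti : Antitone h) (hone : ∀ s s', h s ≤ h s' + 1)
    (ε : ℝ) : volume {s | h (s + ε) < h s} ≤ ENNReal.ofReal ε := by
  -- Two points of the set more than `ε` apart would give two separate drops, while the total
  -- variation of `h` is at most one. So the diameter is at most `ε`.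
  refine (Real.volume_le_diam _).trans (Metric.ediam_le fun x hx y hy => ?_)
  rw [edist_dist, Real.dist_eq]
  refine ENNReal.ofReal_le_ofReal (le_of_not_gt fun hlt => ?_)
  simp only [mem_ofPred_eq] at hx hy
  rcases lt_abs.1 hlt with hc | hc
  · have := hanti (show y + ε ≤ x by linarith)
    have := hone y (x + ε)
    omega
  · have := hanti (show x + ε ≤ y by linarith)
    have := hone x (y + ε)
    omega

section ProductSpace

variable {ι : Type*} [Fintype ι] [DecidableEq ι]

/-- If the sections of `X` in direction `i` have small measure, and `S` implies `G` whatever the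
`i`-th coordinate, then `X ∩ S` has small measure compared to `G`. -/
theorem pi_inter_le_of_section_le (ν : Measure ℝ) [IsProbabilityMeasure ν] (i : ι)
    {X S G : Set (ι → ℝ)} (hX : MeasurableSet X) (hG : MeasurableSet G)
    (c : ℝ≥0∞) (hsec : ∀ t, ν {s | Function.update t i s ∈ X} ≤ c)
    (hSG : ∀ t ∈ S, ∀ s, Function.update t i s ∈ G) :
    Measure.pi (fun _ : ι => ν) (X ∩ S) ≤ c * Measure.pi (fun _ : ι => ν) G := by
  classical
  -- `N` averages the indicator of `G` over the `i`-th coordinate. It equals one on `S` and does not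
  -- depend on that coordinate, so integrating over it first pulls `N` out and leaves only the
  -- section of `X`.
  set N : (ι → ℝ) → ℝ≥0∞ := lmarginal (fun _ : ι => ν) {i} (G.indicator 1) with hN
  have hGm : Measurable (G.indicator (1 : (ι → ℝ) → ℝ≥0∞)) := measurable_one.indicator hG
  have hXm : Measurable (X.indicator (1 : (ι → ℝ) → ℝ≥0∞)) := measurable_one.indicator hX
  have hNm : Measurable N := hGm.lmarginal _
  have hN1 : ∀ t ∈ S, N t = 1 := by
    intro t ht
    simp only [hN, lmarginal_singleton]
    simp [indicator_of_mem (hSG t ht _)]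
  calc Measure.pi (fun _ : ι => ν) (X ∩ S)
      ≤ ∫⁻ t, X.indicator 1 t * N t ∂Measure.pi (fun _ : ι => ν) := by
        refine (measure_mono (t := {t | 1 ≤ X.indicator 1 t * N t}) fun t ht => ?_).trans ?_
        · simp [ht.1, hN1 t ht.2]
        · simpa using mul_meas_ge_le_lintegral (μ := Measure.pi (fun _ : ι => ν))
            (hXm.mul hNm) 1
    _ ≤ ∫⁻ t, c * G.indicator 1 t ∂Measure.pi (fun _ : ι => ν) := by
        refine lintegral_le_of_lmarginal_le (μ := fun _ : ι => ν) {i} (hXm.mul hNm)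
          (hGm.const_mul c) fun t => ?_
        simp only [lmarginal_singleton]
        have h1 : ∀ s, N (Function.update t i s) = N t := fun s =>
          lmarginal_update_of_mem _ (Finset.mem_singleton_self i) _ _ _
        simp only [h1]
        have hupd : Measurable fun s => Function.update t i s := measurable_update t
        rw [lintegral_mul_const _ (show Measurable fun s => X.indicator 1 (Function.update t i s)
            from hXm.comp hupd), lintegral_const_mul _ (show Measurable fun s =>
            G.indicator 1 (Function.update t i s) from hGm.comp hupd)]
        have h2 : N t = ∫⁻ s, G.indicator 1 (Function.update t i s) ∂ν := by
          simp only [hN, lmarginal_singleton]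
        rw [h2]
        gcongr
        refine le_trans (le_of_eq ?_) (hsec t)
        exact lintegral_indicator_one (μ := ν) (hupd hX)
    _ = c * Measure.pi (fun _ : ι => ν) G := by
        rw [lintegral_const_mul _ hGm, lintegral_indicator_one hG]

/-- Induction on `J`. A drop by `J + 1` must include a drop at some single coordinate's shift, which
costs a factor `ε`; a drop by `J` survives any resampling of that coordinate, so the remaining
factor is the previous bound. Summing over coordinates gives the factor `Fintype.card ι`. -/
theorem pi_drop_le {N : (ι → ℝ) → ℕ} (hanti : Antitone N) (hmeas : Measurable N)
    (hone : ∀ t i s, N t ≤ N (Function.update t i s) + 1) (ε : ℝ) (J : ℕ) :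
    Measure.pi (fun _ : ι => volume.restrict (Icc (0 : ℝ) 1))
      {t | J + N (fun i => t i + ε) ≤ N t} ≤ (Fintype.card ι * ENNReal.ofReal ε) ^ J := by
  have : IsProbabilityMeasure (volume.restrict (Icc (0 : ℝ) 1)) := ⟨by simp⟩
  set P := Measure.pi (fun _ : ι => volume.restrict (Icc (0 : ℝ) 1)) with hP
  have hmS : ∀ J, MeasurableSet {t | J + N (fun i => t i + ε) ≤ N t} := fun J =>
    measurableSet_le (measurable_const.add (hmeas.comp (by fun_prop))) hmeas
  -- Changing one coordinate alters both counts by at most one, but by monotonicity only one of the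
  -- two changes can reduce the drop. Hence one is lost, not two.
  have hup : ∀ (J : ℕ) t, J + 1 + N (fun i => t i + ε) ≤ N t → ∀ i s,
      J + N (fun j => Function.update t i s j + ε) ≤ N (Function.update t i s) := by
    intro J t h i s
    have e : (fun j => Function.update t i s j + ε)
        = Function.update (fun j => t j + ε) i (s + ε) := by
      ext j; by_cases hj : j = i
      · subst hj; simp
      · simp [hj]
    rw [e]
    have a1 := hone t i s
    have a2 := hone (Function.update (fun j => t j + ε) i (s + ε)) i (t i + ε)
    have e2 : Function.update (Function.update (fun j => t j + ε) i (s + ε)) i (t i + ε)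
        = fun j => t j + ε := by simp
    rw [e2] at a2
    rcases le_total s (t i) with hs | hs
    · have : N t ≤ N (Function.update t i s) := hanti (by simp [hs])
      omega
    · have : N (Function.update (fun j => t j + ε) i (s + ε)) ≤ N (fun j => t j + ε) :=
        hanti (by simp [hs])
      omega
  induction J with
  | zero => simpa using prob_le_one
  | succ J ih =>
    set S := {t | J + 1 + N (fun i => t i + ε) ≤ N t} with hS
    set G := {t | J + N (fun i => t i + ε) ≤ N t} with hG
    -- Telescoping: the coordinates in `s` are shifted one after another, and each newly shifted
    -- coordinate adds one term to the union bound.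
    have key : ∀ s : Finset ι, P ({t | N (fun i => if i ∈ s then t i + ε else t i) < N t} ∩ S)
        ≤ s.card * ENNReal.ofReal ε * P G := by
      intro s
      induction s using Finset.induction_on with
      | empty => simp
      | insert i s his ihs =>
        set X := {t : ι → ℝ | N (fun j => if j ∈ insert i s then t j + ε else t j)
          < N (fun j => if j ∈ s then t j + ε else t j)} with hX
        have hsh : ∀ s : Finset ι, Measurable fun (t : ι → ℝ) j =>
            if j ∈ s then t j + ε else t j := fun s =>
          measurable_pi_lambda _ fun j => by split_ifs <;> fun_prop
        have hXm : MeasurableSet X :=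
          measurableSet_lt (hmeas.comp (hsh _)) (hmeas.comp (hsh _))
        have hXle : P (X ∩ S) ≤ ENNReal.ofReal ε * P G := by
          refine pi_inter_le_of_section_le _ i hXm (hmS J) _ (fun t => ?_)
            fun t ht s => hup J t ht i s
          -- The uniform law has density at most one, so Lebesgue measure on the line suffices.
          refine (Measure.restrict_apply_le _ _).trans ?_
          set t' : ι → ℝ := fun j => if j ∈ s then t j + ε else t j
          have hh := volume_setOf_drop_le (h := fun r => N (Function.update t' i r))
            (fun a b hab => hanti (update_le_update_iff.2 ⟨hab, fun _ _ => le_rfl⟩))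
            (fun a b => by simpa using hone (Function.update t' i a) i b) ε
          refine le_trans (measure_mono fun r hr => ?_) hh
          simp only [hX, mem_ofPred_eq] at hr ⊢
          convert hr using 2
          · ext j; by_cases hj : j = i
            · subst hj; simp
            · simp [hj, t']
          · ext j; by_cases hj : j = i
            · subst hj; simp [his]
            · simp [hj, t']
        calc _ ≤ P (({t | N (fun i => if i ∈ s then t i + ε else t i) < N t} ∩ S) ∪ (X ∩ S)) := by
              refine measure_mono fun t ht => ?_
              rcases lt_or_ge (N (fun i => if i ∈ s then t i + ε else t i)) (N t) with h | h
              · exact Or.inl ⟨h, ht.2⟩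
              · exact Or.inr ⟨lt_of_lt_of_le ht.1 h, ht.2⟩
          _ ≤ s.card * ENNReal.ofReal ε * P G + ENNReal.ofReal ε * P G :=
              (measure_union_le _ _).trans (add_le_add ihs hXle)
          _ = _ := by
              rw [Finset.card_insert_of_notMem his]; push_cast; ring
    have hfin := key Finset.univ
    have hsub : S ⊆ {t | N (fun i => if i ∈ Finset.univ then t i + ε else t i) < N t} ∩ S := by
      intro t ht
      refine ⟨?_, ht⟩
      simp only [hS, mem_ofPred_eq, Finset.mem_univ, if_true] at ht ⊢
      omega
    calc P S ≤ _ := measure_mono hsub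
      _ ≤ _ := hfin
      _ ≤ Fintype.card ι * ENNReal.ofReal ε * (Fintype.card ι * ENNReal.ofReal ε) ^ J := by
          rw [Finset.card_univ]; gcongr
      _ = _ := by rw [pow_succ']

end ProductSpace

/-! ### Counting eigenvalues of real symmetric matrices -/

section EigenvalueCount

open Matrix

theorem OrthonormalBasis.inner_eq_zero_of_mem_span {ι : Type*} [Fintype ι] {E : Type*} [NormedAddCommGroup E]
    [InnerProductSpace ℝ E] (e : OrthonormalBasis ι ℝ E) {S : Set ι} {x : E}
    (hx : x ∈ Submodule.span ℝ (range fun j : S => e j)) {j : ι} (hj : j ∉ S) :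
    inner ℝ (e j) x = 0 := by
  induction hx using Submodule.span_induction with
  | mem y hy =>
    obtain ⟨i, rfl⟩ := hy
    exact e.orthonormal.2 fun h => hj (h ▸ i.2)
  | zero => simp
  | add y z _ _ hy hz => rw [inner_add_right, hy, hz, add_zero]
  | smul c y _ hy => rw [real_inner_smul_right, hy, mul_zero]

theorem OrthonormalBasis.finrank_span_range_subtype {ι : Type*} [Fintype ι] {E : Type*} [NormedAddCommGroup E]
    [InnerProductSpace ℝ E] (e : OrthonormalBasis ι ℝ E) (S : Set ι) [Fintype S] :
    Module.finrank ℝ (Submodule.span ℝ (range fun j : S => e j)) = Fintype.card S :=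
  finrank_span_eq_card (e.orthonormal.linearIndependent.comp _ Subtype.val_injective)

theorem isHermitian_add_diagonal {ι : Type*} [DecidableEq ι] {A : Matrix ι ι ℝ} (hA : A.IsHermitian) (t : ι → ℝ) :
    (A + diagonal t).IsHermitian :=
  hA.add (isHermitian_diagonal t)

variable {ι : Type*} [Fintype ι] [DecidableEq ι]

/-- The number of eigenvalues in `(-∞, b]`, with multiplicity. -/
noncomputable def eigenvalueCount {A : Matrix ι ι ℝ} (hA : A.IsHermitian) (b : ℝ) : ℕ :=
  (Finset.univ.filter fun j => hA.eigenvalues j ≤ b).card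

theorem inner_toEuclideanLin_eq_sum {A : Matrix ι ι ℝ} (hA : A.IsHermitian)
    (x : EuclideanSpace ℝ ι) :
    inner ℝ x (toEuclideanLin A x)
      = ∑ j, hA.eigenvalues j * inner ℝ (hA.eigenvectorBasis j) x ^ 2 := by
  rw [← hA.eigenvectorBasis.sum_inner_mul_inner]
  refine Finset.sum_congr rfl fun j _ => ?_
  have h1 : toEuclideanLin A (hA.eigenvectorBasis j)
      = hA.eigenvalues j • hA.eigenvectorBasis j := by
    ext i
    exact congrFun (hA.mulVec_eigenvectorBasis j) i
  rw [← (isSymmetric_toEuclideanLin_iff.mpr hA) (hA.eigenvectorBasis j) x, h1,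
    real_inner_smul_left, real_inner_comm]
  ring

theorem norm_sq_eq_sum_inner_sq {A : Matrix ι ι ℝ} (hA : A.IsHermitian)
    (x : EuclideanSpace ℝ ι) :
    ‖x‖ ^ 2 = ∑ j, inner ℝ (hA.eigenvectorBasis j) x ^ 2 := by
  rw [← hA.eigenvectorBasis.sum_sq_norm_inner_right x]
  simp

/-- Variational description of the eigenvalue count. -/
theorem le_eigenvalueCount_iff {A : Matrix ι ι ℝ} (hA : A.IsHermitian) {b : ℝ} {k : ℕ} :
    k ≤ eigenvalueCount hA b ↔ ∃ V : Submodule ℝ (EuclideanSpace ℝ ι),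
      k ≤ Module.finrank ℝ V ∧ ∀ x ∈ V, inner ℝ x (toEuclideanLin A x) ≤ b * ‖x‖ ^ 2 := by
  classical
  set e := hA.eigenvectorBasis
  constructor
  · intro hk
    refine ⟨Submodule.span ℝ (range fun j : {j | hA.eigenvalues j ≤ b} => e j), ?_, ?_⟩
    · rw [e.finrank_span_range_subtype, Fintype.card_subtype]
      exact hk
    · intro x hx
      rw [inner_toEuclideanLin_eq_sum hA, norm_sq_eq_sum_inner_sq hA, Finset.mul_sum]
      refine Finset.sum_le_sum fun j _ => ?_
      by_cases hj : hA.eigenvalues j ≤ b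
      · gcongr
      · rw [e.inner_eq_zero_of_mem_span hx hj]; simp
  · rintro ⟨V, hk, hV⟩
    -- On the span of the eigenvectors above `b` the form strictly exceeds `b * ‖x‖ ^ 2` for nonzero
    -- `x`, so `V` meets it trivially, and its dimension bounds that of `V`.
    set W := Submodule.span ℝ (range fun j : {j | ¬ hA.eigenvalues j ≤ b} => e j)
    have hdisj : Disjoint V W := by
      rw [Submodule.disjoint_def]
      intro x hxV hxW
      have h1 := hV x hxV
      rw [inner_toEuclideanLin_eq_sum hA, norm_sq_eq_sum_inner_sq hA, Finset.mul_sum] at h1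
      have hterm : ∀ j, b * inner ℝ (e j) x ^ 2 ≤ hA.eigenvalues j * inner ℝ (e j) x ^ 2 := by
        intro j
        by_cases hj : hA.eigenvalues j ≤ b
        · rw [e.inner_eq_zero_of_mem_span hxW (by simpa using hj)]; simp
        · have := (not_le.1 hj).le
          gcongr
      have h2 := (Finset.sum_eq_sum_iff_of_le fun j _ => hterm j).1
        (le_antisymm (Finset.sum_le_sum fun j _ => hterm j) h1)
      have h3 : ∀ j, inner ℝ (e j) x = 0 := by
        intro j
        by_cases hj : hA.eigenvalues j ≤ b
        · exact e.inner_eq_zero_of_mem_span hxW (by simpa using hj)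
        · have := h2 j (Finset.mem_univ j)
          have hne : b ≠ hA.eigenvalues j := (not_le.1 hj).ne
          by_contra h0
          exact hne (mul_right_cancel₀ (pow_ne_zero 2 h0) this)
      have : ‖x‖ ^ 2 = 0 := by
        rw [norm_sq_eq_sum_inner_sq hA]
        exact Finset.sum_eq_zero fun j _ => by rw [h3 j]; simp
      simpa using this
    have hd := Submodule.finrank_add_finrank_le_of_disjoint hdisj
    rw [e.finrank_span_range_subtype, Fintype.card_subtype, finrank_euclideanSpace] at hd
    have := Finset.card_filter_add_card_filter_not (s := (Finset.univ : Finset ι))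
      (fun j => hA.eigenvalues j ≤ b)
    rw [Finset.card_univ] at this
    simp only [mem_ofPred_eq] at hd
    unfold eigenvalueCount
    omega

/-- There are finitely many eigenvalues, so a small gap above `b` is free of them. This
right-continuity feeds the semicontinuity of `diagonalCount`. -/
theorem exists_pos_eigenvalueCount_add_eq {A : Matrix ι ι ℝ} (hA : A.IsHermitian) (b : ℝ) :
    ∃ δ : ℝ, 0 < δ ∧ eigenvalueCount hA (b + δ) = eigenvalueCount hA b := by
  have h : ∀ᶠ δ in nhdsWithin (0 : ℝ) (Ioi 0), ∀ j, b < hA.eigenvalues j →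
      b + δ < hA.eigenvalues j := by
    rw [Filter.eventually_all]
    intro j
    by_cases hj : b < hA.eigenvalues j
    · have : ∀ᶠ δ in nhdsWithin (0 : ℝ) (Ioi 0), δ < hA.eigenvalues j - b :=
        nhdsWithin_le_nhds (eventually_lt_nhds (by linarith))
      filter_upwards [this] with δ hδ _
      linarith
    · exact Filter.Eventually.of_forall fun _ h => absurd h hj
  obtain ⟨δ, hδ, hpos⟩ := (h.and self_mem_nhdsWithin).exists
  have hpos : 0 < δ := hpos
  refine ⟨δ, hpos, ?_⟩
  unfold eigenvalueCount
  congr 1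
  ext j
  simp only [Finset.mem_filter, Finset.mem_univ, true_and]
  exact ⟨fun h1 => not_lt.1 fun h2 => absurd (hδ j h2) (not_lt.2 h1), fun h1 => by linarith⟩

theorem trace_spectralProjection {A : Matrix ι ι ℝ} (hA : A.IsHermitian) (I : Set ℝ) :
    (spectralProjection hA I).trace = ∑ j, I.indicator 1 (hA.eigenvalues j) := by
  unfold spectralProjection IsHermitian.cfc
  rw [Unitary.conjStarAlgAut_apply, trace_mul_cycle, Unitary.coe_star_mul_self, one_mul,
    trace_diagonal]
  rfl

theorem trace_spectralProjection_add_eigenvalueCount_le {A : Matrix ι ι ℝ} (hA : A.IsHermitian)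
    {I : Set ℝ} {a b : ℝ} (hab : a ≤ b) (hI : I ⊆ Ioc a b) :
    (spectralProjection hA I).trace + eigenvalueCount hA a ≤ eigenvalueCount hA b := by
  rw [trace_spectralProjection]
  unfold eigenvalueCount
  rw [Finset.card_filter, Finset.card_filter]
  push_cast
  rw [← Finset.sum_add_distrib]
  refine Finset.sum_le_sum fun j _ => ?_
  by_cases hj : hA.eigenvalues j ∈ I
  · have := hI hj
    simp [hj, this.2, not_le.2 this.1]
  · by_cases h2 : hA.eigenvalues j ≤ a
    · simp [hj, h2, h2.trans hab]
    · simp only [hj, h2, not_false_eq_true, indicator_of_notMem, if_false, add_zero]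
      split_ifs <;> norm_num

/-! ### Diagonal perturbations -/

/-- The number of eigenvalues of `A + diagonal t` in `(-∞, b]`. -/
noncomputable def diagonalCount {A : Matrix ι ι ℝ} (hA : A.IsHermitian) (b : ℝ) (t : ι → ℝ) : ℕ :=
  eigenvalueCount (isHermitian_add_diagonal hA t) b

theorem inner_toEuclideanLin_add_diagonal (A : Matrix ι ι ℝ) (t : ι → ℝ)
    (x : EuclideanSpace ℝ ι) :
    inner ℝ x (toEuclideanLin (A + diagonal t) x)
      = inner ℝ x (toEuclideanLin A x) + ∑ i, t i * x i ^ 2 := by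
  rw [map_add, LinearMap.add_apply, inner_add_right]
  congr 1
  simp only [PiLp.inner_apply, toLpLin_apply, mulVec_diagonal, RCLike.inner_apply, conj_trivial]
  exact Finset.sum_congr rfl fun i _ => by ring

variable {A : Matrix ι ι ℝ} (hA : A.IsHermitian)

theorem diagonalCount_antitone (b : ℝ) : Antitone (diagonalCount hA b) := by
  intro s t hst
  obtain ⟨V, hV, hx⟩ := (le_eigenvalueCount_iff (isHermitian_add_diagonal hA t)).1
    (le_refl (eigenvalueCount (isHermitian_add_diagonal hA t) b))
  refine (le_eigenvalueCount_iff _).2 ⟨V, hV, fun x hxV => le_trans ?_ (hx x hxV)⟩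
  rw [inner_toEuclideanLin_add_diagonal, inner_toEuclideanLin_add_diagonal]
  gcongr with i
  exact hst i

/-- Intersecting a test subspace with the hyperplane `x i = 0` costs at most one dimension and makes
the form blind to the `i`-th diagonal entry. -/
theorem diagonalCount_le_update_add_one (b : ℝ) (t : ι → ℝ) (i : ι) (s : ℝ) :
    diagonalCount hA b t ≤ diagonalCount hA b (Function.update t i s) + 1 := by
  obtain ⟨V, hV, hx⟩ := (le_eigenvalueCount_iff (isHermitian_add_diagonal hA t)).1
    (le_refl (eigenvalueCount (isHermitian_add_diagonal hA t) b))
  suffices diagonalCount hA b t - 1 ≤ diagonalCount hA b (Function.update t i s) by omega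
  set p : EuclideanSpace ℝ ι →ₗ[ℝ] ℝ := (EuclideanSpace.proj i).toLinearMap with hp
  refine (le_eigenvalueCount_iff _).2 ⟨V ⊓ LinearMap.ker p, ?_, fun x hxV => ?_⟩
  · have h1 := Submodule.finrank_sup_add_finrank_inf_eq V (LinearMap.ker p)
    have h2 := LinearMap.finrank_range_add_finrank_ker p
    have h3 : Module.finrank ℝ (LinearMap.range p) ≤ 1 := by
      simpa using Submodule.finrank_le (LinearMap.range p)
    have h4 := Submodule.finrank_le (V ⊔ LinearMap.ker p)
    have : diagonalCount hA b t ≤ Module.finrank ℝ V := hV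
    omega
  · have hxi : x i = 0 := hxV.2
    refine le_trans (le_of_eq ?_) (hx x hxV.1)
    rw [inner_toEuclideanLin_add_diagonal, inner_toEuclideanLin_add_diagonal]
    congr 1
    refine Finset.sum_congr rfl fun j _ => ?_
    by_cases hj : j = i
    · subst hj; simp [hxi]
    · simp [hj]

theorem diagonalCount_add_const (b c : ℝ) (t : ι → ℝ) :
    diagonalCount hA b (fun i => t i + c) = diagonalCount hA (b - c) t := by
  refine eq_of_forall_le_iff fun k => ?_
  rw [diagonalCount, diagonalCount, le_eigenvalueCount_iff, le_eigenvalueCount_iff]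
  refine exists_congr fun V => and_congr_right fun _ => forall₂_congr fun x _ => ?_
  rw [inner_toEuclideanLin_add_diagonal, inner_toEuclideanLin_add_diagonal]
  simp only [add_mul, Finset.sum_add_distrib, ← Finset.mul_sum, EuclideanSpace.norm_sq_eq,
    Real.norm_eq_abs, sq_abs]
  constructor <;> intro h <;> linarith

/-- Serves measurability. Near `t` every diagonal dominates `t - δ`, whose count at `b` is the count
of `t` at `b + δ`, equal to that at `b` for small `δ`. -/
theorem diagonalCount_upperSemicontinuous (b : ℝ) :
    UpperSemicontinuous (diagonalCount hA b) := by
  intro t k hk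
  obtain ⟨δ, hδ, he⟩ := exists_pos_eigenvalueCount_add_eq (isHermitian_add_diagonal hA t) b
  have h1 : diagonalCount hA b (fun i => t i + -δ) < k := by
    rw [diagonalCount_add_const, sub_neg_eq_add]
    exact he.trans_lt hk
  filter_upwards [Metric.ball_mem_nhds t hδ] with s hs
  refine (diagonalCount_antitone hA b fun i => ?_).trans_lt h1
  have := (dist_le_pi_dist s t i).trans_lt hs
  rw [Real.dist_eq] at this
  have := (abs_lt.1 this).1
  linarith

theorem measurable_diagonalCount (b : ℝ) : Measurable (diagonalCount hA b) :=
  (diagonalCount_upperSemicontinuous hA b).measurable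

end EigenvalueCount

theorem finiteVolume_eq_add_diagonal {d : ℕ} (W : LatticeZ d → ℝ) (Λ : Finset (LatticeZ d)) :
    finiteVolume W Λ = finiteVolume (fun _ => 0) Λ + Matrix.diagonal fun x : Λ => W x := by
  ext x y
  by_cases h : x = y
  · subst h; simp [finiteVolume, schrodinger]
  · have : (x : LatticeZ d) ≠ y := fun h' => h (Subtype.ext h')
    simp [finiteVolume, schrodinger, h, this]

/-! ### The fibre bound: freezing all but one generation -/

/-- The frozen part `r` depends only on coefficients outside the range of `e`, hence is independent
of the selected ones. Fubini reduces to `pi_drop_le` for each value of `r`, with `ε` rescaled by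
`l`. -/
theorem measure_drop_le_of_iIndepFun {ι σ Θ : Type*} [Fintype ι] [DecidableEq ι]
    [MeasurableSpace Θ] {μ : Measure Θ} [IsProbabilityMeasure μ] {X : σ → Θ → ℝ}
    (hX : ∀ i, Measurable (X i)) (hlaw : ∀ i, μ.map (X i) = volume.restrict (Icc (0 : ℝ) 1))
    (hind : iIndepFun X μ) {e : ι → σ} (he : Function.Injective e) {r : Θ → ι → ℝ}
    (hr : Measurable[⨆ i ∈ (range e)ᶜ, MeasurableSpace.comap (X i) inferInstance] r)
    {N : (ι → ℝ) → ℕ} (hanti : Antitone N) (hmeas : Measurable N)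
    (hone : ∀ t i s, N t ≤ N (Function.update t i s) + 1) {l : ℝ} (hl : 0 < l) (ε : ℝ) (J : ℕ) :
    μ {ϑ | J + N (fun i => r ϑ i + l * X (e i) ϑ + ε) ≤ N (fun i => r ϑ i + l * X (e i) ϑ)}
      ≤ (Fintype.card ι * ENNReal.ofReal (ε / l)) ^ J := by
  have hle : ∀ i, MeasurableSpace.comap (X i) inferInstance ≤ (inferInstance : MeasurableSpace Θ) :=
    fun i => (hX i).comap_le
  have hrm : Measurable r := hr.mono (iSup₂_le fun i _ => hle i) le_rfl
  set Y : Θ → ι → ℝ := fun ϑ i => X (e i) ϑ with hY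
  have hYm : Measurable Y := measurable_pi_lambda _ fun i => hX _
  have hYlaw : μ.map Y = Measure.pi fun _ : ι => volume.restrict (Icc (0 : ℝ) 1) := by
    rw [(iIndepFun_iff_map_fun_eq_pi_map fun i => (hX (e i)).aemeasurable).1 (hind.precomp he)]
    simp only [hlaw]
  have hrY : IndepFun r Y μ := by
    rw [IndepFun_iff_Indep]
    have h1 := indep_iSup_of_disjoint hle ((iIndepFun_iff_iIndep _ _ _).1 hind)
      (disjoint_compl_left (a := range e))
    refine indep_of_indep_of_le_right (indep_of_indep_of_le_left h1 hr.comap_le) ?_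
    refine Measurable.comap_le ?_
    refine @measurable_pi_lambda _ _ _ (_) _ _ fun i => ?_
    refine Measurable.mono (comap_measurable (X (e i))) ?_ le_rfl
    exact le_iSup₂_of_le (e i) (mem_range_self i) le_rfl
  have : IsProbabilityMeasure (μ.map r) := Measure.isProbabilityMeasure_map hrm.aemeasurable
  have : IsProbabilityMeasure (volume.restrict (Icc (0 : ℝ) 1)) := ⟨by simp⟩
  set M : Set ((ι → ℝ) × (ι → ℝ)) :=
    {p | J + N (fun i => p.1 i + l * p.2 i + ε) ≤ N (fun i => p.1 i + l * p.2 i)} with hM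
  have hMm : MeasurableSet M :=
    measurableSet_le (measurable_const.add (hmeas.comp (by fun_prop))) (hmeas.comp (by fun_prop))
  calc μ {ϑ | J + N (fun i => r ϑ i + l * X (e i) ϑ + ε) ≤ N (fun i => r ϑ i + l * X (e i) ϑ)}
      = μ.map (fun ϑ => (r ϑ, Y ϑ)) M := by
        rw [Measure.map_apply (hrm.prodMk hYm) hMm]; rfl
    _ = ∫⁻ a, Measure.pi (fun _ : ι => volume.restrict (Icc (0 : ℝ) 1)) (Prod.mk a ⁻¹' M)
          ∂(μ.map r) := by
        rw [hrY.map_prod_eq_prod_map_map hrm.aemeasurable hYm.aemeasurable, hYlaw,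
          Measure.prod_apply hMm]
    _ ≤ ∫⁻ _, (Fintype.card ι * ENNReal.ofReal (ε / l)) ^ J ∂(μ.map r) := by
        refine lintegral_mono fun a => ?_
        have h := pi_drop_le (N := fun t => N fun i => a i + l * t i)
          (fun s t hst => hanti fun i => by have := hst i; gcongr)
          (hmeas.comp (by fun_prop)) (fun t i s => ?_) (ε / l) J
        · refine le_trans (le_of_eq ?_) h
          congr 1
          ext t
          have : ∀ i, a i + l * t i + ε = a i + l * (t i + ε / l) := fun i => by
            field_simp; ring
          simp only [hM, mem_preimage, mem_ofPred_eq, this]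
        · convert hone (fun i => a i + l * t i) i (a i + l * s) using 3
          ext j; by_cases hj : j = i
          · subst hj; simp
          · simp [hj]
    _ = _ := by simp

/-! ### Randelette expansions at separated points -/

namespace Randelettes

variable {ν : ℕ} {R : Randelettes ν}

theorem IsRegular.a_pos (hR : R.IsRegular) (n : ℕ) : 0 < R.a n := by
  obtain ⟨κ, c, hκ, -, h⟩ := hR.amplitude
  exact lt_of_lt_of_le (mul_pos hκ (Real.exp_pos _)) (h n)

theorem UniformIID.ae_mem_Icc {Θ : Type*} [MeasurableSpace Θ] {μ : Measure Θ}
    {θ : (n : ℕ) → Fin (R.K n) → Θ → ℝ} (hθ : R.UniformIID μ θ) :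
    ∀ᵐ ϑ ∂μ, ∀ n k, θ n k ϑ ∈ Icc (0 : ℝ) 1 := by
  rw [ae_all_iff]; intro n
  rw [ae_all_iff]; intro k
  refine ae_of_ae_map (hθ.measurable n k).aemeasurable (p := fun x => x ∈ Icc (0 : ℝ) 1) ?_
  rw [hθ.law]
  exact ae_restrict_mem measurableSet_Icc

theorem summable_of_abs_le (hR : R.IsRegular) (ω : Torus ν) {y : (n : ℕ) → Fin (R.K n) → ℝ}
    (hy : ∀ n k, |y n k| ≤ 1) : Summable fun n => R.a n * ∑ k, y n k * R.φ n k ω := by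
  refine Summable.of_norm_bounded (hR.summable ω) fun n => ?_
  rw [Real.norm_eq_abs, abs_mul, abs_of_pos (hR.a_pos n)]
  refine mul_le_mul_of_nonneg_left ?_ (hR.a_pos n).le
  refine (Finset.abs_sum_le_sum_abs _ _).trans (Finset.sum_le_sum fun k _ => ?_)
  rw [abs_mul]
  exact mul_le_of_le_one_left (abs_nonneg _) (hy n k)

/-- Splitting off from the expansion the randelettes of generation `n` indexed by `s`. -/
theorem tsum_eq_add_of_eq_one (hR : R.IsRegular) (ω : Torus ν)
    {y : (n : ℕ) → Fin (R.K n) → ℝ} (hy : ∀ n k, |y n k| ≤ 1)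
    {s : Set ((n : ℕ) × Fin (R.K n))} [DecidablePred (· ∈ s)] {n : ℕ} {k₀ : Fin (R.K n)}
    (hs : ∀ i ∈ s, i.1 = n) (hk₀ : ⟨n, k₀⟩ ∈ s) (hone : R.φ n k₀ ω = 1)
    (hzero : ∀ k, ⟨n, k⟩ ∈ s → k ≠ k₀ → R.φ n k ω = 0) :
    ∑' m, R.a m * ∑ k, y m k * R.φ m k ω
      = (∑' m, R.a m * ∑ k, (if ⟨m, k⟩ ∈ s then 0 else y m k) * R.φ m k ω)
        + R.a n * y n k₀ := by
  have hy' : ∀ m k, |if (⟨m, k⟩ : (n : ℕ) × Fin (R.K n)) ∈ s then 0 else y m k| ≤ 1 := by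
    intro m k; split_ifs
    · simp
    · exact hy m k
  have h2 : ∑' m, (if m = n then R.a n * y n k₀ else 0) = R.a n * y n k₀ := tsum_ite_eq n _
  rw [← h2, ← (summable_of_abs_le hR ω hy').tsum_add (hasSum_ite_eq n _).summable]
  refine tsum_congr fun m => ?_
  by_cases hm : m = n
  · subst hm
    rw [if_pos rfl, ← mul_add]
    congr 1
    rw [← sub_eq_iff_eq_add', ← Finset.sum_sub_distrib, Finset.sum_eq_single k₀]
    · simp [hk₀, hone]
    · intro k _ hk
      by_cases h : (⟨m, k⟩ : (n : ℕ) × Fin (R.K n)) ∈ s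
      · simp [hzero k h hk]
      · simp [h]
    · simp
  · rw [if_neg hm, add_zero]
    congr 1
    refine Finset.sum_congr rfl fun k _ => ?_
    rw [if_neg fun h => hm (hs _ h)]

/-- Measurability is asked only of coefficients outside `s`, so the lemma applies with the σ-algebra
that those coefficients generate. -/
theorem measurable_tsum_ite {Θ : Type*} [MeasurableSpace Θ]
    {θ : (n : ℕ) → Fin (R.K n) → Θ → ℝ} (s : Set ((n : ℕ) × Fin (R.K n))) [DecidablePred (· ∈ s)]
    (hθ : ∀ i ∉ s, Measurable (θ i.1 i.2)) (ω : Torus ν) :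
    Measurable fun ϑ => ∑' m, R.a m * ∑ k, (if ⟨m, k⟩ ∈ s then 0 else θ m k ϑ) * R.φ m k ω := by
  refine Measurable.tsum fun m => Measurable.const_mul
    (Finset.measurable_sum _ fun k _ => Measurable.mul_const ?_ _) _
  by_cases h : (⟨m, k⟩ : (n : ℕ) × Fin (R.K n)) ∈ s
  · simp only [h, if_true]; exact measurable_const
  · simp only [h, if_false]; exact hθ ⟨m, k⟩ h

/-- A Minami bound for the hull at finitely many points of the torus which are separated on the
scale of the generation `n`. -/
theorem measure_hull_drop_le (hR : R.IsRegular) {Θ : Type*} [MeasurableSpace Θ] {μ : Measure Θ}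
    [IsProbabilityMeasure μ] {θ : (n : ℕ) → Fin (R.K n) → Θ → ℝ} (hθ : R.UniformIID μ θ)
    {ι : Type*} [Fintype ι] [DecidableEq ι] (p : ι → Torus ν) {n : ℕ} (hn : 1 ≤ n)
    (hp : ∀ x y, x ≠ y → ∀ k, Metric.diam (tsupport (R.φ n k)) < dist (p x) (p y))
    {N : (ι → ℝ) → ℕ} (hanti : Antitone N) (hmeas : Measurable N)
    (hone : ∀ t i s, N t ≤ N (Function.update t i s) + 1) {g : ℝ} (hg : 0 < g) (ε : ℝ) (J : ℕ) :
    μ {ϑ | J + N (fun x => g * R.hull θ (p x) ϑ + ε) ≤ N (fun x => g * R.hull θ (p x) ϑ)}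
      ≤ (Fintype.card ι * ENNReal.ofReal (ε / (g * R.a n))) ^ J := by
  classical
  -- The randelette `k x` is one at `p x`; its support is too small to reach another `p y`. This
  -- also makes `k` injective.
  choose k hk using fun x => hR.covering n hn (p x)
  have hk0 : ∀ x y, x ≠ y → R.φ n (k x) (p y) = 0 := by
    intro x y hxy
    refine image_eq_zero_of_notMem_tsupport fun hy => ?_
    refine (hp x y hxy (k x)).not_ge
      (Metric.dist_le_diam_of_mem (isClosed_tsupport _).isCompact.isBounded ?_ hy)
    exact subset_tsupport _ (by simp [hk x])
  set e : ι → (n : ℕ) × Fin (R.K n) := fun x => ⟨n, k x⟩ with he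
  have hinj : Function.Injective e := by
    intro x y hxy
    by_contra hne
    have h1 : k x = k y := by simpa [he] using hxy
    have h2 := hk0 x y hne
    rw [h1, hk y] at h2
    exact one_ne_zero h2
  set r : Θ → ι → ℝ := fun ϑ x => g * ∑' m, R.a m * ∑ j,
    (if ⟨m, j⟩ ∈ range e then 0 else θ m j ϑ) * R.φ m j (p x) with hr
  have hrm : Measurable[⨆ i ∈ (range e)ᶜ,
      MeasurableSpace.comap (fun ϑ => θ i.1 i.2 ϑ) inferInstance] r := by
    refine @measurable_pi_lambda _ _ _ (_) _ _ fun x => ?_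
    refine @Measurable.const_mul _ _ _ _ _ (_) _
      (@measurable_tsum_ite _ R _ (_) _ (range e) _ (fun i hi => ?_) (p x)) g
    refine Measurable.mono (comap_measurable (θ i.1 i.2)) ?_ le_rfl
    exact le_iSup₂_of_le (f := fun (i : (n : ℕ) × Fin (R.K n)) (_ : i ∈ (range e)ᶜ) =>
      MeasurableSpace.comap (fun ϑ => θ i.1 i.2 ϑ) inferInstance) i hi le_rfl
  have hmain := measure_drop_le_of_iIndepFun (X := fun (i : (n : ℕ) × Fin (R.K n)) => θ i.1 i.2)
    (fun i => hθ.measurable _ _) (fun i => hθ.law _ _) hθ.indep hinj hrm hanti hmeas hone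
    (mul_pos hg (hR.a_pos n)) ε J
  refine le_trans (measure_mono_ae ?_) hmain
  -- Splitting the series needs its convergence, known only for bounded coefficients, hence almost
  -- surely.
  filter_upwards [hθ.ae_mem_Icc] with ϑ hϑ
  have hsplit : ∀ x, g * R.hull θ (p x) ϑ = r ϑ x + g * R.a n * θ (e x).1 (e x).2 ϑ := by
    intro x
    rw [hull, tsum_eq_add_of_eq_one hR (p x) (y := fun m j => θ m j ϑ) (s := range e)
      (n := n) (k₀ := k x) (fun m j => abs_le.2 ⟨by linarith [(hϑ m j).1], (hϑ m j).2⟩)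
      ?_ ⟨x, rfl⟩ (hk x) ?_]
    · simp only [hr, he]; ring
    · rintro _ ⟨y, rfl⟩; rfl
    · rintro j ⟨y, hy⟩ hj
      have hy' : k y = j := by simpa [he] using hy
      rw [← hy'] at hj ⊢
      exact hk0 y x fun h => hj (by rw [h])
  intro h
  change J + N (fun x => g * R.hull θ (p x) ϑ + ε) ≤ N (fun x => g * R.hull θ (p x) ϑ) at h
  simp only [hsplit] at h
  exact h

theorem measurable_hull (hR : R.IsRegular) {Θ : Type*} [MeasurableSpace Θ] {μ : Measure Θ}
    {θ : (n : ℕ) → Fin (R.K n) → Θ → ℝ} (hθ : R.UniformIID μ θ) :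
    Measurable fun p : Torus ν × Θ => R.hull θ p.1 p.2 := by
  refine Measurable.tsum fun m => Measurable.const_mul (Finset.measurable_sum _ fun j _ => ?_) _
  exact ((hθ.measurable m j).comp measurable_snd).mul ((hR.measurable m j).comp measurable_fst)

end Randelettes

/-! ### Geometry of the cube and choice of the generation -/

theorem mem_cube {d : ℕ} {u x : LatticeZ d} {L : ℝ} : x ∈ cube u L ↔ dist x u ≤ L := by
  simp [cube]

theorem card_cube_le {d : ℕ} (u : LatticeZ d) {L : ℝ} (hL : 1 ≤ L) :
    ((cube u L).card : ℝ) ≤ (3 * L) ^ d := by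
  have hsub : cube u L ⊆ Fintype.piFinset fun i => Finset.Icc (u i - ⌊L⌋) (u i + ⌊L⌋) := by
    intro x hx
    rw [mem_cube] at hx
    refine Fintype.mem_piFinset.2 fun i => ?_
    have h := (dist_le_pi_dist x u i).trans hx
    rw [Int.dist_eq, ← Int.cast_sub, ← Int.cast_abs, ← Int.le_floor, abs_le] at h
    rw [Finset.mem_Icc]
    omega
  have hfl : (0 : ℤ) ≤ ⌊L⌋ := Int.floor_nonneg.2 (by linarith)
  calc ((cube u L).card : ℝ)
      ≤ ((Fintype.piFinset fun i => Finset.Icc (u i - ⌊L⌋) (u i + ⌊L⌋)).card : ℝ) := by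
        exact_mod_cast Finset.card_le_card hsub
    _ = ∏ i : Fin d, ((2 * ⌊L⌋ + 1 : ℤ) : ℝ) := by
        rw [Fintype.card_piFinset]
        push_cast
        refine Finset.prod_congr rfl fun i _ => ?_
        rw [Int.card_Icc]
        have : ((u i + ⌊L⌋ + 1 - (u i - ⌊L⌋)).toNat : ℤ) = 2 * ⌊L⌋ + 1 := by omega
        have := congrArg (Int.cast : ℤ → ℝ) this
        push_cast at this
        exact this
    _ ≤ ∏ _i : Fin d, (3 * L) := by
        refine Finset.prod_le_prod (fun i _ => by positivity) fun i _ => ?_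
        push_cast
        have := Int.floor_le L
        linarith
    _ = (3 * L) ^ d := by simp

/-- Take `n` just above `logb 2 b + A * logb 2 L`, where `2 ^ (-n)` falls below the orbit separation
at distance `2 * L`. Since `n` is logarithmic in `L`, the exponential loss is polynomial, with `q =
c * A / log 2`. -/
theorem exists_generation {A C D κ c : ℝ} (hA : 0 < A) (hC : 0 < C) (hκ : 0 < κ) (hc : 0 < c) :
    ∃ M q : ℝ, 0 < M ∧ 0 < q ∧ ∀ L : ℝ, 1 ≤ L → ∃ n : ℕ, 1 ≤ n ∧
      D * 2 ^ (-(n : ℝ)) < 4 * C * (2 * L) ^ (-A) ∧ (κ * Real.exp (-(c * n)))⁻¹ ≤ M * L ^ q := by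
  have h2 : 0 < Real.log 2 := Real.log_pos one_lt_two
  -- `D` need not be positive; the maximum makes the logarithm of `b` usable.
  set b : ℝ := (max D 1) * 2 ^ A / (4 * C) with hb
  have hbpos : 0 < b := by positivity
  refine ⟨κ⁻¹ * Real.exp (c * (|Real.logb 2 b| + 2)), c * A / Real.log 2, by positivity,
    by positivity, fun L hL => ?_⟩
  have hL0 : 0 < L := by linarith
  have hlogL : 0 ≤ Real.log L := Real.log_nonneg hL
  set α := Real.logb 2 b + A * Real.logb 2 L with hα
  have h2α : (2 : ℝ) ^ α = b * L ^ A := by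
    rw [hα, Real.rpow_add two_pos, Real.rpow_logb two_pos (by norm_num) hbpos, mul_comm A,
      Real.rpow_mul two_pos.le, Real.rpow_logb two_pos (by norm_num) hL0]
  -- The extra one gives both `1 ≤ n` and the strict inequality.
  refine ⟨⌈α⌉₊ + 1, by omega, ?_, ?_⟩
  · have hlt : b * L ^ A < 2 ^ ((⌈α⌉₊ + 1 : ℕ) : ℝ) := by
      rw [← h2α]
      refine Real.rpow_lt_rpow_of_exponent_lt one_lt_two ?_
      push_cast
      linarith [Nat.le_ceil α]
    rw [Real.rpow_neg two_pos.le, Real.rpow_neg (by positivity), ← div_eq_mul_inv,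
      ← div_eq_mul_inv, div_lt_div_iff₀ (by positivity) (by positivity),
      Real.mul_rpow two_pos.le hL0.le]
    calc D * (2 ^ A * L ^ A) ≤ max D 1 * (2 ^ A * L ^ A) := by
          gcongr; exact le_max_left _ _
      _ = 4 * C * (b * L ^ A) := by rw [hb]; field_simp
      _ < _ := by gcongr
  · have hle : ((⌈α⌉₊ + 1 : ℕ) : ℝ) ≤ |Real.logb 2 b| + 2 + A * Real.logb 2 L := by
      have h0 : 0 ≤ A * Real.logb 2 L := mul_nonneg hA.le (div_nonneg hlogL h2.le)
      have h1 : (⌈α⌉₊ : ℝ) < |Real.logb 2 b| + A * Real.logb 2 L + 1 := by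
        refine lt_of_le_of_lt ?_ (Nat.ceil_lt_add_one (by positivity))
        exact_mod_cast Nat.ceil_mono (by rw [hα]; gcongr; exact le_abs_self _)
      push_cast
      linarith
    rw [mul_inv, Real.exp_neg, inv_inv, mul_assoc]
    gcongr
    rw [Real.rpow_def_of_pos hL0, ← Real.exp_add]
    refine Real.exp_le_exp.2 ((mul_le_mul_of_nonneg_left hle hc.le).trans (le_of_eq ?_))
    rw [Real.logb, Real.logb]
    ring

theorem exists_subset_Icc_of_ordConnected {I : Set ℝ} (hI : I.OrdConnected)
    (hbd : Bornology.IsBounded I) :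
    ∃ a b : ℝ, a ≤ b ∧ I ⊆ Icc a b ∧ b - a ≤ volume.real I := by
  rcases I.eq_empty_or_nonempty with rfl | hne
  · exact ⟨0, 0, le_rfl, empty_subset _, by simp⟩
  have hab : sInf I ≤ sSup I := csInf_le_csSup hne hbd.bddBelow hbd.bddAbove
  refine ⟨sInf I, sSup I, hab, subset_Icc_csInf_csSup hbd.bddBelow hbd.bddAbove, ?_⟩
  have hsub : Ioo (sInf I) (sSup I) ⊆ I := by
    rintro x ⟨hx1, hx2⟩
    obtain ⟨y, hy, hyx⟩ := exists_lt_of_csInf_lt hne hx1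
    obtain ⟨z, hz, hxz⟩ := exists_lt_of_lt_csSup hne hx2
    exact hI.out hy hz ⟨hyx.le, hxz.le⟩
  have := measureReal_mono (μ := volume) hsub hbd.measure_lt_top.ne
  rwa [Real.volume_real_Ioo_of_le hab] at this

/-! ### Integration over the torus and conclusion -/

theorem volume_torus_univ (ν : ℕ) : volume (univ : Set (Torus ν)) = 1 := by
  rw [volume_pi, Measure.pi_univ]
  simp [AddCircle.measure_univ]

/-- The Minami-type bound for half-open intervals, in terms of a generation that separates the
orbit points indexed by the cube. -/
theorem measureReal_trace_spectralProjection_ge_le {d ν : ℕ} {Θ : Type*} [MeasurableSpace Θ]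
    (μ : Measure Θ) [IsProbabilityMeasure μ]
    (T : LatticeZ d → Torus ν → Torus ν) (hT : ∀ x, Measurable (T x))
    {R : Randelettes ν} (hR : R.IsRegular)
    {θ : (n : ℕ) → Fin (R.K n) → Θ → ℝ} (hθ : R.UniformIID μ θ)
    {g : ℝ} (hg : 0 < g) (J : ℕ) (Λ : Finset (LatticeZ d)) {n : ℕ} (hn : 1 ≤ n)
    (hsep : ∀ ω, ∀ x ∈ Λ, ∀ y ∈ Λ, x ≠ y → ∀ k,
      Metric.diam (tsupport (R.φ n k)) < dist (T x ω) (T y ω))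
    {I : Set ℝ} {a b : ℝ} (hab : a ≤ b) (hI : I ⊆ Ioc a b) :
    (volume.prod μ).real {p : Torus ν × Θ |
        (J : ℝ) ≤ (spectralProjection (finiteVolume_isHermitian
          (fun x => g * R.hull θ (T x p.1) p.2) Λ) I).trace}
      ≤ (Λ.card * ((b - a) / (g * R.a n))) ^ J := by
  set A := finiteVolume (fun _ : LatticeZ d => 0) Λ
  have hA : A.IsHermitian := finiteVolume_isHermitian _ _
  set N := diagonalCount hA b
  set w : Torus ν × Θ → Λ → ℝ := fun p x => g * R.hull θ (T x p.1) p.2 with hw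
  have hwm : Measurable w := by
    refine measurable_pi_lambda _ fun x => Measurable.const_mul ?_ g
    exact (Randelettes.measurable_hull hR hθ).comp
      (((hT x).comp measurable_fst).prodMk measurable_snd)
  set E : Set (Torus ν × Θ) := {p | J + N (fun x => w p x + (b - a)) ≤ N (w p)} with hE
  have hEm : MeasurableSet E :=
    measurableSet_le (measurable_const.add ((measurable_diagonalCount hA b).comp (by fun_prop)))
      ((measurable_diagonalCount hA b).comp hwm)
  have ha := hR.a_pos n
  have hnonneg : 0 ≤ (b - a) / (g * R.a n) := div_nonneg (by linarith) (by positivity)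
  refine ENNReal.toReal_le_of_le_ofReal (by positivity) ?_
  calc (volume.prod μ) _ ≤ (volume.prod μ) E := by
        refine measure_mono fun p hp => ?_
        have h := trace_spectralProjection_add_eigenvalueCount_le
          (finiteVolume_isHermitian (fun x => g * R.hull θ (T x p.1) p.2) Λ) hab hI
        have hp : (J : ℝ) ≤ (spectralProjection (finiteVolume_isHermitian
          (fun x => g * R.hull θ (T x p.1) p.2) Λ) I).trace := hp
        have hcount : ∀ c, eigenvalueCount (finiteVolume_isHermitian
            (fun x => g * R.hull θ (T x p.1) p.2) Λ) c = diagonalCount hA c (w p) := by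
          intro c
          unfold diagonalCount
          congr 1
          exact finiteVolume_eq_add_diagonal _ _
        rw [hcount, hcount] at h
        change J + diagonalCount hA b (fun x => w p x + (b - a)) ≤ diagonalCount hA b (w p)
        rw [diagonalCount_add_const, sub_sub_cancel]
        have : (J : ℝ) + diagonalCount hA a (w p) ≤ diagonalCount hA b (w p) := by linarith
        exact_mod_cast this
    _ = ∫⁻ ω, μ (Prod.mk ω ⁻¹' E) := Measure.prod_apply hEm
    _ ≤ ∫⁻ _ : Torus ν, ENNReal.ofReal ((Λ.card * ((b - a) / (g * R.a n))) ^ J) := by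
        refine lintegral_mono fun ω => ?_
        have h := Randelettes.measure_hull_drop_le hR hθ (fun x : Λ => T x ω) hn
          (fun x y hxy k => hsep ω x x.2 y y.2 (fun h => hxy (Subtype.ext h)) k)
          (diagonalCount_antitone hA b) (measurable_diagonalCount hA b)
          (diagonalCount_le_update_add_one hA b) hg (b - a) J
        refine le_trans h (le_of_eq ?_)
        rw [Fintype.card_coe, ENNReal.ofReal_pow (by positivity),
          ENNReal.ofReal_mul (by positivity), ENNReal.ofReal_natCast]
    _ = _ := by rw [lintegral_const, volume_torus_univ, mul_one]

theorem mainTheorem2 {d ν : ℕ} {Θ : Type*} [MeasurableSpace Θ]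
    (μ : Measure Θ) [IsProbabilityMeasure μ]
    (T : LatticeZ d → Torus ν → Torus ν) (hT : IsDynamicalSystem T)
    (hUSR : UniformlySlowReturns T)
    (R : Randelettes ν) (hR : R.IsRegular)
    (θ : (n : ℕ) → Fin (R.K n) → Θ → ℝ) (hθ : R.UniformIID μ θ)
    (g : ℝ) (hg : 0 < g) (J : ℕ) :
    ∃ B₀ : ℝ, 0 < B₀ ∧ ∀ B' : ℝ, B₀ ≤ B' → ∃ C : ℝ, 0 < C ∧
      ∀ I : Set ℝ, I.OrdConnected → Bornology.IsBounded I →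
      ∀ (u : LatticeZ d) (L : ℝ), 1 ≤ L →
        (volume.prod μ).real {p : Torus ν × Θ |
            (J : ℝ) ≤ (spectralProjection (finiteVolume_isHermitian
              (fun x => g * R.hull θ (T x p.1) p.2) (cube u L)) I).trace}
          ≤ C * L ^ B' * volume.real I ^ J := by
  obtain ⟨A, C, hA, hC, hret⟩ := hUSR
  obtain ⟨D, hD⟩ := hR.diam_support
  obtain ⟨κ, c, hκ, hc, hamp⟩ := hR.amplitude
  obtain ⟨M, q, hM, hq, hgen⟩ := exists_generation (D := D) hA hC hκ hc
  -- `d` comes from the cardinality of the cube and `q` from `1 / a n`; the added one keeps the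
  -- threshold positive when `J = 0`.
  refine ⟨(d + q) * J + 1, by positivity, fun B' hB' => ⟨(3 ^ d * M / g) ^ J, by positivity, ?_⟩⟩
  intro I hI hbd u L hL
  have hL0 : 0 < L := by linarith
  obtain ⟨a, b, hab, hIab, hlen⟩ := exists_subset_Icc_of_ordConnected hI hbd
  obtain ⟨n, hn, hsmall, hinv⟩ := hgen L hL
  have ha := hR.a_pos n
  have hsep : ∀ ω, ∀ x ∈ cube u L, ∀ y ∈ cube u L, x ≠ y → ∀ k,
      Metric.diam (tsupport (R.φ n k)) < dist (T x ω) (T y ω) := by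
    intro ω x hx y hy hxy k
    refine ((hD n k).trans_lt hsmall).trans_le (le_trans ?_ (hret ω x y hxy))
    rw [mem_cube] at hx hy
    have h1 : ‖x - y‖ ≤ 2 * L := by
      rw [← dist_eq_norm]
      linarith [dist_triangle_right x y u]
    have h2 : 0 < ‖x - y‖ := norm_pos_iff.2 (sub_ne_zero.2 hxy)
    have := Real.rpow_le_rpow_of_nonpos h2 h1 (neg_nonpos.2 hA.le)
    gcongr
  -- The left endpoint may belong to `I`, so the interval is enlarged to `Ioc (a - δ) b`, and `δ`
  -- tends to zero at the end.
  have hδ : ∀ δ : ℝ, 0 < δ → (volume.prod μ).real {p : Torus ν × Θ |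
      (J : ℝ) ≤ (spectralProjection (finiteVolume_isHermitian
        (fun x => g * R.hull θ (T x p.1) p.2) (cube u L)) I).trace}
      ≤ (3 ^ d * M / g) ^ J * L ^ B' * (volume.real I + δ) ^ J := by
    intro δ hδ
    have h := measureReal_trace_spectralProjection_ge_le μ T
      (fun x => (hT.measurePreserving x).measurable) hR hθ hg J (cube u L) hn hsep
      (I := I) (a := a - δ) (b := b) (by linarith)
      (fun x hx => ⟨by linarith [(hIab hx).1], (hIab hx).2⟩)
    have hainv : (R.a n)⁻¹ ≤ M * L ^ q := le_trans (by gcongr; exact hamp n) hinv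
    have hv : 0 ≤ volume.real I := measureReal_nonneg
    calc _ ≤ _ := h
      _ = ((cube u L).card * ((b - (a - δ)) / g * (R.a n)⁻¹)) ^ J := by
          rw [← div_div, div_eq_mul_inv _ (R.a n)]
      _ ≤ ((3 * L) ^ d * ((volume.real I + δ) / g * (M * L ^ q))) ^ J := by
          have h0 : 0 ≤ b - (a - δ) := by linarith
          have h1 := card_cube_le u hL
          have h2 : b - (a - δ) ≤ volume.real I + δ := by linarith
          gcongr
      _ = (3 ^ d * M / g) ^ J * L ^ ((d + q) * J) * (volume.real I + δ) ^ J := by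
          rw [Real.rpow_mul hL0.le, Real.rpow_natCast, Real.rpow_add hL0, Real.rpow_natCast,
            ← mul_pow, ← mul_pow, mul_pow 3 L]
          congr 1
          ring
      _ ≤ _ := by
          have : L ^ ((d + q) * J) ≤ L ^ B' :=
            Real.rpow_le_rpow_of_exponent_le hL (by linarith)
          gcongr
  have hlim : Filter.Tendsto (fun δ : ℝ => (3 ^ d * M / g) ^ J * L ^ B' * (volume.real I + δ) ^ J)
      (nhdsWithin 0 (Ioi 0)) (nhds ((3 ^ d * M / g) ^ J * L ^ B' * volume.real I ^ J)) := by
    have hcont : Continuous fun δ : ℝ =>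
        (3 ^ d * M / g) ^ J * L ^ B' * (volume.real I + δ) ^ J := by fun_prop
    have := hcont.tendsto 0
    rw [add_zero] at this
    exact this.mono_left nhdsWithin_le_nhds
  refine ge_of_tendsto hlim ?_
  filter_upwards [self_mem_nhdsWithin] with δ h
  exact hδ δ h
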